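/- Let $G$ be a simple graph with vertex set $X$ and let $A$ be a finite set. Let $\mathfrak{B}(\varphi_G^A)$ be the universal unital $*$-algebra over $\mathbb{C}$ with generators $e_{x,a,b}$ ($x\in X$, $a,b\in A$) and relations $$e_{x,a,b}\,e_{x,c,d}=\delta_{b,c}\,e_{x,a,d},\qquad e_{x,a,b}^*=e_{x,b,a},\qquad \sum_{a\in A}e_{x,a,a}=1,$$ $$\sum_{a,b\in A}e_{x,a,b}\,e_{y,b,a}=0\quad\text{whenever } x\sim y \text{ in } G,$$ and let $\mathcal{B}(\varphi_G^A)$ be the universal unital C*-algebra with the same generators and relations. The algebraic orthogonal rank $\xi_{\rm alg}(G)$ (respectively the C*-algebraic orthogonal rank $\xi_{C^*}(G)$) is the smallest cardinality of a finite set $A$ for which $\mathfrak{B}(\varphi_G^A)\neq\{0\}$ (respectively $\mathcal{B}(\varphi_G^A)\neq\{0\}$), and is $\infty$ if no such $A$ exists. Let $K_{d^2}$ be the complete graph on $d^2$ vertices. Then $$\xi_{\rm alg}(K_{d^2})=2\qquad\text{for every integer } d\ge 2.$$ Moreover, the algebraic orthogonal rank can be strictly smaller than the C*-algebraic one: $\xi_{\rm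 alg}(K_{d^2})<\xi_{C^*}(K_{d^2})$ for every integer $d\ge 3$. -/

import Mathlib

open scoped ENNReal

noncomputable section

namespace CQColouring

universe u v

variable {X : Type u} (G : SimpleGraph X) (A : Type v) [Fintype A]

/-- The defining relations of the algebra of the classical-to-quantum colouring game of `G` with
output set `A`, on free generators `e (x, a, b)`: for each vertex `x` the `e (x, a, b)` form a
system of matrix units summing to `1`, and `∑ a b, e (x, a, b) * e (y, b, a) = 0` if `x ∼ y`.
(The relation `star (e (x, a, b)) = e (x, b, a)` is built into the involution below.) -/
inductive Rel : FreeAlgebra ℂ (X × A × A) → FreeAlgebra ℂ (X × A × A) → Prop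
  | mul_same (x : X) (a b c : A) :
      Rel (FreeAlgebra.ι ℂ (x, a, b) * FreeAlgebra.ι ℂ (x, b, c)) (FreeAlgebra.ι ℂ (x, a, c))
  | mul_ne (x : X) (a b c d : A) (h : b ≠ c) :
      Rel (FreeAlgebra.ι ℂ (x, a, b) * FreeAlgebra.ι ℂ (x, c, d)) 0
  | sum_diag (x : X) : Rel (∑ a : A, FreeAlgebra.ι ℂ (x, a, a)) 1
  | adj (x y : X) (h : G.Adj x y) :
      Rel (∑ a : A, ∑ b : A, FreeAlgebra.ι ℂ (x, a, b) * FreeAlgebra.ι ℂ (y, b, a)) 0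

/-- The algebra of the classical-to-quantum colouring game: the universal unital `*`-algebra over
`ℂ` generated by matrix unit systems `e x a b` (`a, b ∈ A`), one for each vertex `x`, subject to
`∑ a b, e x a b * e y b a = 0` whenever `x ∼ y`. -/
def GameAlgebra : Type (max u v) := RingQuot (Rel G A)

namespace GameAlgebra

instance : Ring (GameAlgebra G A) := inferInstanceAs (Ring (RingQuot (Rel G A)))

instance : Algebra ℂ (GameAlgebra G A) := inferInstanceAs (Algebra ℂ (RingQuot (Rel G A)))

/-- The quotient map from the free algebra. -/
def mk : FreeAlgebra ℂ (X × A × A) →ₐ[ℂ] GameAlgebra G A := RingQuot.mkAlgHom ℂ (Rel G A)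

/-- The canonical generators (matrix units). -/
def e (x : X) (a b : A) : GameAlgebra G A := mk G A (FreeAlgebra.ι ℂ (x, a, b))

variable {G A}

theorem mk_surjective : Function.Surjective (mk G A) := RingQuot.mkAlgHom_surjective ℂ _

theorem mk_rel {p q : FreeAlgebra ℂ (X × A × A)} (h : Rel G A p q) : mk G A p = mk G A q :=
  RingQuot.mkAlgHom_rel ℂ h

theorem e_mul_same (x : X) (a b c : A) : e G A x a b * e G A x b c = e G A x a c := by
  simpa [e] using mk_rel (Rel.mul_same (G := G) x a b c)

theorem e_mul_ne (x : X) (a b c d : A) (h : b ≠ c) : e G A x a b * e G A x c d = 0 := by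
  simpa [e] using mk_rel (Rel.mul_ne (G := G) x a b c d h)

theorem e_sum_diag (x : X) : ∑ a : A, e G A x a a = 1 := by
  simpa [e] using mk_rel (Rel.sum_diag (G := G) (A := A) x)

theorem e_adj (x y : X) (h : G.Adj x y) :
    ∑ a : A, ∑ b : A, e G A x a b * e G A y b a = 0 := by
  simpa [e] using mk_rel (Rel.adj (A := A) x y h)

/-- Induction on the generators. -/
theorem induction {P : GameAlgebra G A → Prop} (hs : ∀ z : ℂ, P (algebraMap ℂ _ z))
    (he : ∀ x a b, P (e G A x a b)) (hm : ∀ p q, P p → P q → P (p * q))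
    (ha : ∀ p q, P p → P q → P (p + q)) (p : GameAlgebra G A) : P p := by
  obtain ⟨p, rfl⟩ := mk_surjective p
  induction p using FreeAlgebra.induction with
  | grade0 z => simpa using hs z
  | grade1 i => exact he i.1 i.2.1 i.2.2
  | mul p q hp hq => simpa using hm _ _ hp hq
  | add p q hp hq => simpa using ha _ _ hp hq

variable (G A)

/-- The opposite algebra with scalar multiplication twisted by complex conjugation: `ℂ`-algebra
homomorphisms into it are conjugate-linear anti-homomorphisms into the algebra itself. -/
@[reducible] def conjOp : Algebra ℂ (GameAlgebra G A)ᵐᵒᵖ :=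
  RingHom.toAlgebra' ((algebraMap ℂ (GameAlgebra G A)ᵐᵒᵖ).comp (starRingEnd ℂ))
    (fun z p => Algebra.commutes (R := ℂ) (starRingEnd ℂ z) p)

/-- The involution, as a ring homomorphism into the opposite ring. -/
def starHom : GameAlgebra G A →+* (GameAlgebra G A)ᵐᵒᵖ :=
  letI := conjOp G A
  (RingQuot.liftAlgHom ℂ (s := Rel G A)
    ⟨FreeAlgebra.lift ℂ fun i : X × A × A => MulOpposite.op (e G A i.1 i.2.2 i.2.1), by
      intro p q h
      apply MulOpposite.unop_injective
      induction h with
      | mul_same x a b c => simp [e_mul_same]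
      | mul_ne x a b c d h => simp [e_mul_ne x d c b a h.symm]
      | sum_diag x => simp [e_sum_diag]
      | adj x y h =>
        simp only [map_sum, map_mul, FreeAlgebra.lift_ι_apply, map_zero, Finset.unop_sum,
          MulOpposite.unop_mul, MulOpposite.unop_op, MulOpposite.unop_zero]
        exact e_adj y x h.symm⟩).toRingHom

variable {G A}

theorem starHom_e (x : X) (a b : A) :
    starHom G A (e G A x a b) = MulOpposite.op (e G A x b a) := by
  let _ := conjOp G A
  exact (RingQuot.liftAlgHom_mkAlgHom_apply ℂ _ _ _).trans (FreeAlgebra.lift_ι_apply _ _)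

theorem starHom_algebraMap (z : ℂ) :
    starHom G A (algebraMap ℂ _ z) = MulOpposite.op (algebraMap ℂ _ (starRingEnd ℂ z)) := by
  let _ := conjOp G A
  exact AlgHom.commutes (RingQuot.liftAlgHom ℂ (s := Rel G A) _) z

/-- The conjugate-linear involution determined by `star (e x a b) = e x b a`. -/
instance : StarRing (GameAlgebra G A) where
  star p := (starHom G A p).unop
  star_involutive p := by
    induction p using GameAlgebra.induction with
    | hs z => simp [starHom_algebraMap]
    | he x a b => simp [starHom_e]
    | hm p q hp hq => simp [hp, hq]
    | ha p q hp hq => simp [hp, hq]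
  star_mul p q := by simp
  star_add p q := by simp

theorem star_e (x : X) (a b : A) : star (e G A x a b) = e G A x b a := by
  change (starHom G A _).unop = _
  rw [starHom_e, MulOpposite.unop_op]

theorem star_algebraMap' (z : ℂ) :
    star (algebraMap ℂ (GameAlgebra G A) z) = algebraMap ℂ _ (star z) := by
  change (starHom G A _).unop = _
  rw [starHom_algebraMap, MulOpposite.unop_op]; rfl

instance : StarModule ℂ (GameAlgebra G A) where
  star_smul z p := by
    rw [Algebra.smul_def, star_mul, star_algebraMap', Algebra.smul_def, Algebra.commutes]

end GameAlgebra

/-- A unital `*`-representation of the game algebra in a nonzero C*-algebra. -/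
structure CStarRep where
  carrier : Type (max u v)
  [alg : CStarAlgebra carrier]
  [nontriv : Nontrivial carrier]
  hom : GameAlgebra G A →⋆ₐ[ℂ] carrier

attribute [instance] CStarRep.alg CStarRep.nontriv

/-- The elements of the game algebra are uniformly bounded over all representations. -/
theorem exists_norm_le (p : GameAlgebra G A) : ∃ C : ℝ, ∀ π : CStarRep G A, ‖π.hom p‖ ≤ C := by
  induction p using GameAlgebra.induction with
  | hs z => exact ⟨‖z‖, fun π => by rw [AlgHomClass.commutes, norm_algebraMap']⟩
  | he x a b =>
    refine ⟨1, fun π => ?_⟩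
    have key : ∀ c d : A, ‖π.hom (GameAlgebra.e G A x c d)‖ * ‖π.hom (GameAlgebra.e G A x c d)‖
        = ‖π.hom (GameAlgebra.e G A x d d)‖ := fun c d => by
      rw [← CStarRing.norm_star_mul_self, ← map_star, ← map_mul, GameAlgebra.star_e,
        GameAlgebra.e_mul_same]
    have h1 := key a b
    have h2 := key b b
    have h3 : ‖π.hom (GameAlgebra.e G A x b b)‖ ≤ 1 := by
      nlinarith [norm_nonneg (π.hom (GameAlgebra.e G A x b b))]
    nlinarith [norm_nonneg (π.hom (GameAlgebra.e G A x a b))]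
  | hm p q hp hq =>
    obtain ⟨C, hC⟩ := hp
    obtain ⟨D, hD⟩ := hq
    exact ⟨C * D, fun π => by
      rw [map_mul]
      exact (norm_mul_le _ _).trans
        (mul_le_mul (hC π) (hD π) (norm_nonneg _) ((norm_nonneg _).trans (hC π)))⟩
  | ha p q hp hq =>
    obtain ⟨C, hC⟩ := hp
    obtain ⟨D, hD⟩ := hq
    exact ⟨C + D, fun π => by
      rw [map_add]
      exact (norm_add_le _ _).trans (add_le_add (hC π) (hD π))⟩

/-- The direct sum of all representations of the game algebra; it induces on the game algebra the
largest C*-seminorm `p ↦ ⨆ π, ‖π p‖`. -/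
def universalRep :
    GameAlgebra G A →⋆ₐ[ℂ] lp (fun π : CStarRep G A => π.carrier) ∞ where
  toFun p := ⟨fun π => π.hom p, memℓp_infty (by
    obtain ⟨C, hC⟩ := exists_norm_le G A p
    exact ⟨C, by rintro _ ⟨π, rfl⟩; exact hC π⟩)⟩
  map_one' := by ext π; exact map_one π.hom
  map_mul' p q := by ext π; exact map_mul π.hom p q
  map_zero' := by ext π; exact map_zero π.hom
  map_add' p q := by ext π; exact map_add π.hom p q
  commutes' z := by ext π; exact AlgHomClass.commutes π.hom z
  map_star' p := by ext π; exact map_star π.hom p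

/-- The C*-algebra of the classical-to-quantum colouring game: the universal unital C*-algebra
generated by matrix unit systems subject to the same relations, i.e. the (Hausdorff) completion of
the game algebra in its largest C*-seminorm, realised as the norm closure of the image of the game
algebra in the direct sum of all its representations. -/
def cstarGameAlgebra : StarSubalgebra ℂ (lp (fun π : CStarRep G A => π.carrier) ∞) :=
  (universalRep G A).range.topologicalClosure

/-- The algebraic orthogonal rank: the least cardinality of a finite set `A` for which the game
algebra is nonzero, and `∞` if there is none. -/
def algOrthRank : ℕ∞ :=
  sInf {k : ℕ∞ | ∃ n : ℕ, k = n ∧ Nontrivial (GameAlgebra G (Fin n))}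

/-- The C*-algebraic orthogonal rank: the least cardinality of a finite set `A` for which the
C*-algebra of the game is nonzero, and `∞` if there is none. -/
def cstarOrthRank : ℕ∞ :=
  sInf {k : ℕ∞ | ∃ n : ℕ, k = n ∧ Nontrivial (cstarGameAlgebra G (Fin n))}

end CQColouring

end

/-! For two outputs, nontriviality holds for every graph. It suffices to find spaces `V`, `U` and,
for each vertex `x`, mutually inverse maps `V → U²` (row entries `s x a`) and `U² → V` (entries `t x
a`) with `∑ b, s x b * t y b = 0` for `x ≠ y`; then `t x a * s x b` satisfies all relations. Such
maps come from a rewriting system: `s x 1 * t y 1` becomes `-s x 0 * t y 0`, `t x 0 * s x 0` becomes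
`1 - t x 1 * s x 1`, and the operators act on reduced words.

In a C*-algebra, positivity intervenes. The matrices `n⁻¹ (e x a b)` over vertices of a complete
graph are pairwise orthogonal projections, so their sum `q` is a projection. The trace of `1 - q` is
the scalar `n - |X| / n`, and it is a sum of squares, so `|X| ≤ n²` (`card_le_sq_of_cstarRep`). With
`d²` vertices this forces `n ≥ d > 2`. -/

namespace CQColouring

universe u

/-! ### Operators on reduced words -/

section Words

variable {X : Type u}

/-- The letter `(b, y, x)` stands for the product `t y b * s x 0`; `StartsWith x w` says that the
word `w` begins with some `t x b`. -/
def StartsWith (x : X) : List (Bool × X × X) → Prop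
  | [] => False
  | l :: _ => l.2.1 = x

/-- Reduced words: no factors `s x 0 * t x b` and `t x 0 * s x 0`. The index `0` is represented by
`false`, the index `1` by `true`. -/
def Reduced : List (Bool × X × X) → Prop
  | [] => True
  | l :: w => Reduced w ∧ ¬ StartsWith l.2.2 w ∧ (l.1 = false → l.2.2 ≠ l.2.1)

variable (X) in
/-- The reduced words. -/
abbrev VWord : Type u := {w : List (Bool × X × X) // Reduced w}

variable (X) in
/-- The reduced words with a letter `s x 0` prefixed. -/
abbrev UWord : Type u := {p : X × List (Bool × X × X) // Reduced p.2 ∧ ¬ StartsWith p.1 p.2}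

/-- Prefixing `t y 1`. -/
def prefixOne (y : X) (p : UWord X) : VWord X :=
  ⟨(true, y, p.1.1) :: p.1.2, p.2.1, p.2.2, by simp⟩

/-- Prefixing `t y 0`. -/
def prefixZero (y : X) (p : UWord X) (h : p.1.1 ≠ y) : VWord X :=
  ⟨(false, y, p.1.1) :: p.1.2, p.2.1, p.2.2, fun _ => h⟩

/-- The free module on the reduced words. -/
abbrev VSpace (X : Type u) : Type u := VWord X →₀ ℂ

/-- The free module on the words beginning with some `s x 0`. -/
abbrev USpace (X : Type u) : Type u := UWord X →₀ ℂ

open Classical in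
/-- The operator `s x 0` on words. -/
noncomputable def sZeroWord (x : X) : VWord X → USpace X
  | ⟨[], _⟩ => Finsupp.single ⟨(x, []), trivial, fun h => h⟩ 1
  | ⟨(b, y, z) :: w, h⟩ =>
    if hy : y = x then
      if b = false then Finsupp.single ⟨(z, w), h.1, h.2.1⟩ 1 else 0
    else Finsupp.single ⟨(x, (b, y, z) :: w), h, hy⟩ 1

/-- The operator `s x 0`. -/
noncomputable def sZero (x : X) : VSpace X →ₗ[ℂ] USpace X :=
  Finsupp.linearCombination ℂ (sZeroWord x)

/-- The operator `t y 1`. -/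
noncomputable def tOne (y : X) : USpace X →ₗ[ℂ] VSpace X :=
  Finsupp.linearCombination ℂ fun p => Finsupp.single (prefixOne y p) 1

open Classical in
/-- The operator `s x 1` on words. -/
noncomputable def sOneWord : (w : List (Bool × X × X)) → Reduced w → X → USpace X
  -- No relation constrains this value, so zero is a free choice.
  | [], _, _ => 0
  | (b, y, z) :: w, h, x =>
    if y = x then
      if b = false then 0 else Finsupp.single ⟨(z, w), h.1, h.2.1⟩ 1
    else
      -- Another free choice: the relations link `s x 1` only with `t y 1` when `y ≠ x`.
      if b = false then 0
      else if hz : z = y then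
        -- The argument is `t y 0 * s y 0` applied to `w`, expanded by hand because `tZero` depends
        -- on `sOne`; the recursive call is on the shorter word `w`.
        - sZero x (Finsupp.single ⟨w, h.1⟩ 1 - tOne y (sOneWord w h.1 y))
      else - sZero x (Finsupp.single (prefixZero y ⟨(z, w), h.1, h.2.1⟩ hz) 1)

/-- The operator `s x 1`. -/
noncomputable def sOne (x : X) : VSpace X →ₗ[ℂ] USpace X :=
  Finsupp.linearCombination ℂ fun w => sOneWord w.1 w.2 x

open Classical in
/-- The operator `t y 0`. -/
noncomputable def tZero (y : X) : USpace X →ₗ[ℂ] VSpace X :=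
  Finsupp.linearCombination ℂ fun p =>
    if h : p.1.1 = y then
      Finsupp.single ⟨p.1.2, p.2.1⟩ 1 - tOne y (sOne y (Finsupp.single ⟨p.1.2, p.2.1⟩ 1))
    else Finsupp.single (prefixZero y p h) 1

theorem sZero_single (x : X) (w : VWord X) :
    sZero x (Finsupp.single w 1) = sZeroWord x w := by
  simp [sZero]

theorem sOne_single (x : X) (w : VWord X) :
    sOne x (Finsupp.single w 1) = sOneWord w.1 w.2 x := by
  simp [sOne]

theorem tOne_single (y : X) (p : UWord X) :
    tOne y (Finsupp.single p 1) = Finsupp.single (prefixOne y p) 1 := by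
  simp [tOne]

theorem tZero_single_of_eq (y : X) (p : UWord X) (h : p.1.1 = y) :
    tZero y (Finsupp.single p 1) = Finsupp.single ⟨p.1.2, p.2.1⟩ 1 -
      tOne y (sOne y (Finsupp.single ⟨p.1.2, p.2.1⟩ 1)) := by
  simp [tZero, h]

theorem tZero_single_of_ne (y : X) (p : UWord X) (h : p.1.1 ≠ y) :
    tZero y (Finsupp.single p 1) = Finsupp.single (prefixZero y p h) 1 := by
  simp [tZero, h]

theorem sZero_comp_tOne_self (x : X) : sZero x ∘ₗ tOne x = 0 := by
  ext p : 2
  simp [tOne_single, sZero_single, prefixOne, sZeroWord]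

theorem sOne_comp_tOne_self (x : X) : sOne x ∘ₗ tOne x = LinearMap.id := by
  ext p : 2
  simp [tOne_single, sOne_single, prefixOne, sOneWord]

theorem sZeroWord_of_not_startsWith (x : X) (w : VWord X) (h : ¬ StartsWith x w.1) :
    sZeroWord x w = Finsupp.single ⟨(x, w.1), w.2, h⟩ 1 := by
  obtain ⟨_ | ⟨⟨b, y, z⟩, w⟩, hw⟩ := w
  · rfl
  · have hy : y ≠ x := h
    simp [sZeroWord, hy]

theorem sZero_comp_tZero_self (x : X) : sZero x ∘ₗ tZero x = LinearMap.id := by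
  ext p : 2
  have h1 (u) : sZero x (tOne x u) = 0 := LinearMap.congr_fun (sZero_comp_tOne_self x) u
  by_cases h : p.1.1 = x
  · obtain ⟨⟨z, w⟩, hw⟩ := p
    obtain rfl : z = x := h
    simp only [LinearMap.comp_apply, Finsupp.lsingle_apply, tZero_single_of_eq, map_sub, h1,
      sZero_single, LinearMap.id_apply, sub_zero]
    exact sZeroWord_of_not_startsWith _ _ hw.2
  · simp [tZero_single_of_ne x p h, sZero_single, prefixZero, sZeroWord]

theorem sOne_comp_tZero_self (x : X) : sOne x ∘ₗ tZero x = 0 := by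
  ext p : 2
  have h1 (u) : sOne x (tOne x u) = u := LinearMap.congr_fun (sOne_comp_tOne_self x) u
  by_cases h : p.1.1 = x
  · simp [tZero_single_of_eq x p h, h1]
  · simp [tZero_single_of_ne x p h, sOne_single, prefixZero, sOneWord]

/-- On a word starting with `t x b`, one summand restores the word and the other vanishes. On any
other word `s x 0` merely prefixes a letter, and `tZero` was defined there as the required
remainder. -/
theorem tZero_comp_sZero_add (x : X) :
    tZero x ∘ₗ sZero x + tOne x ∘ₗ sOne x = LinearMap.id := by
  ext w : 2
  by_cases h : StartsWith x w.1
  · obtain ⟨_ | ⟨⟨b, y, z⟩, w⟩, hw⟩ := w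
    · exact h.elim
    · obtain rfl : y = x := h
      cases b
      · simp [sZero_single, sOne_single, sZeroWord, sOneWord,
          tZero_single_of_ne y ⟨(z, w), hw.1, hw.2.1⟩ (hw.2.2 rfl), prefixZero]
      · simp [sZero_single, sOne_single, sZeroWord, sOneWord, tOne_single, prefixOne]
  · simp [sZero_single, sZeroWord_of_not_startsWith x w h, tZero_single_of_eq]

/-- Built into `sOneWord`, whose value on a word starting with `t y 1` is minus the first summand.
-/
theorem sZero_comp_tZero_add {x y : X} (h : x ≠ y) :
    sZero x ∘ₗ tZero y + sOne x ∘ₗ tOne y = 0 := by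
  ext p : 2
  obtain ⟨⟨z, w⟩, hw⟩ := p
  by_cases hz : z = y
  · subst hz
    simp [tZero_single_of_eq, tOne_single, sOne_single, prefixOne, sOneWord, h.symm]
  · simp [tZero_single_of_ne y ⟨(z, w), hw⟩ hz, tOne_single, sOne_single, prefixOne, sOneWord,
      h.symm, hz]

end Words

/-! ### The algebraic rank -/

section Algebraic

variable {X : Type u} {G : SimpleGraph X}

/-- A ring containing solutions of the defining relations witnesses that the game algebra is
nonzero. -/
theorem nontrivial_gameAlgebra_of_relations {A : Type*} [Fintype A] {R : Type*} [Ring R]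
    [Algebra ℂ R] [Nontrivial R] (f : X → A → A → R)
    (mul_same : ∀ x a b c, f x a b * f x b c = f x a c)
    (mul_ne : ∀ x a b c d, b ≠ c → f x a b * f x c d = 0)
    (sum_diag : ∀ x, ∑ a, f x a a = 1)
    (adj : ∀ x y, G.Adj x y → ∑ a, ∑ b, f x a b * f y b a = 0) :
    Nontrivial (GameAlgebra G A) := by
  let φ : GameAlgebra G A →ₐ[ℂ] R := RingQuot.liftAlgHom ℂ (s := Rel G A)
    ⟨FreeAlgebra.lift ℂ fun i : X × A × A => f i.1 i.2.1 i.2.2, by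
      intro p q h
      induction h with
      | mul_same x a b c => simp [mul_same]
      | mul_ne x a b c d h => simp [mul_ne x a b c d h]
      | sum_diag x => simp [sum_diag]
      | adj x y h => simp [adj x y h]⟩
  exact φ.toRingHom.domain_nontrivial

theorem nontrivial_gameAlgebra_fin_two : Nontrivial (GameAlgebra G (Fin 2)) := by
  let s : X → Fin 2 → (VSpace X →ₗ[ℂ] USpace X) := fun x => ![sZero x, sOne x]
  let t : X → Fin 2 → (USpace X →ₗ[ℂ] VSpace X) := fun x => ![tZero x, tOne x]
  have hst (x : X) (a b : Fin 2) :
      s x a ∘ₗ t x b = if a = b then LinearMap.id else 0 := by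
    fin_cases a <;> fin_cases b <;>
      simp [s, t, sZero_comp_tZero_self, sZero_comp_tOne_self, sOne_comp_tZero_self,
        sOne_comp_tOne_self]
  have : Nonempty (VWord X) := ⟨⟨[], trivial⟩⟩
  refine nontrivial_gameAlgebra_of_relations (R := Module.End ℂ (VSpace X))
    (fun x a b => t x a ∘ₗ s x b) ?_ ?_ ?_ ?_
  · intro x a b c
    change t x a ∘ₗ (s x b ∘ₗ t x b) ∘ₗ s x c = _
    simp [hst]
  · intro x a b c d h
    change t x a ∘ₗ (s x b ∘ₗ t x c) ∘ₗ s x d = _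
    simp [hst, h]
  · intro x
    rw [Fin.sum_univ_two]
    exact tZero_comp_sZero_add x
  · intro x y h
    -- Each summand over `a` of the adjacency relation is this inner sum between `t x a` and `s y
    -- a`.
    have key : ∑ b, s x b ∘ₗ t y b = 0 := by
      simpa [s, t, Fin.sum_univ_two] using sZero_comp_tZero_add h.ne
    refine Finset.sum_eq_zero fun a _ => ?_
    change ∑ b, t x a ∘ₗ (s x b ∘ₗ t y b) ∘ₗ s y a = _
    refine LinearMap.ext fun w => ?_
    have hw := LinearMap.congr_fun key (s y a w)
    simp only [LinearMap.sum_apply, LinearMap.comp_apply, LinearMap.zero_apply] at hw ⊢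
    rw [← map_sum, hw, map_zero]

theorem two_le_of_nontrivial_gameAlgebra {n : ℕ} {x y : X} (h : G.Adj x y)
    (hn : Nontrivial (GameAlgebra G (Fin n))) : 2 ≤ n := by
  by_contra! hlt
  interval_cases n
  · simpa using GameAlgebra.e_sum_diag (G := G) (A := Fin 0) x
  · have hx := GameAlgebra.e_sum_diag (G := G) (A := Fin 1) x
    have hy := GameAlgebra.e_sum_diag (G := G) (A := Fin 1) y
    have hxy := GameAlgebra.e_adj (A := Fin 1) x y h
    simp only [Finset.univ_unique, Finset.sum_singleton] at hx hy hxy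
    rw [hx, hy] at hxy
    simp at hxy

theorem algOrthRank_eq_two {x y : X} (h : G.Adj x y) : algOrthRank G = 2 := by
  apply le_antisymm
  · exact sInf_le ⟨2, rfl, nontrivial_gameAlgebra_fin_two⟩
  · refine le_sInf ?_
    rintro _ ⟨n, rfl, hn⟩
    exact_mod_cast two_le_of_nontrivial_gameAlgebra h hn

end Algebraic

/-! ### The C*-algebraic bound -/

section CStar

variable {X : Type u} {G : SimpleGraph X}

/-- Multiplying the adjacency relation by `e x a a` on the left and `e y a b` on the right isolates
one row: the scalar relation is already orthogonality of matrices. -/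
theorem GameAlgebra.sum_e_mul_e {A : Type*} [Fintype A] {x y : X}
    (h : G.Adj x y) (a b : A) : ∑ c, e G A x a c * e G A y c b = 0 := by
  classical
  have key := congr_arg (fun p => e G A x a a * p * e G A y a b) (e_adj (A := A) x y h)
  simp only [Finset.mul_sum, Finset.sum_mul, mul_zero, zero_mul] at key
  rw [Finset.sum_eq_single a] at key
  · rw [← key]
    refine Finset.sum_congr rfl fun c _ => ?_
    rw [← mul_assoc, e_mul_same, mul_assoc, e_mul_same]
  · intro c _ hc
    refine Finset.sum_eq_zero fun d _ => ?_
    rw [← mul_assoc, e_mul_ne x a a c d hc.symm, zero_mul, zero_mul]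
  · simp

/-- A nontrivial C*-algebra does not contain a negative scalar that is a sum of squares. -/
theorem nonneg_of_sum_star_mul_self_eq_algebraMap {B : Type*} [CStarAlgebra B] [Nontrivial B]
    {ι : Type*} (s : Finset ι) (p : ι → B) {r : ℝ}
    (h : ∑ i ∈ s, star (p i) * p i = algebraMap ℝ B r) : 0 ≤ r := by
  let _ := CStarAlgebra.spectralOrder B
  have _ := CStarAlgebra.spectralOrderedRing B
  have h0 : 0 ≤ algebraMap ℝ B r := h ▸ Finset.sum_nonneg fun i _ => star_mul_self_nonneg (p i)
  exact spectrum_nonneg_of_nonneg h0 (by simp [spectrum.scalar_eq])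

theorem card_le_sq_of_cstarRep [Fintype X] {n : ℕ} (hG : ∀ x y, x ≠ y → G.Adj x y) [Nonempty X]
    (π : CStarRep G (Fin n)) : Fintype.card X ≤ n ^ 2 := by
  classical
  let f (x : X) (a b : Fin n) : π.carrier := π.hom (GameAlgebra.e G (Fin n) x a b)
  have hdiag (x : X) : ∑ a, f x a a = 1 := by
    simp only [f, ← map_sum, GameAlgebra.e_sum_diag, map_one]
  have hmul (x y : X) (a b : Fin n) :
      ∑ c, f x a c * f y c b = if x = y then (n : ℝ) • f x a b else 0 := by
    split_ifs with h
    · subst h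
      simp only [f, ← map_mul, GameAlgebra.e_mul_same]
      simp [Nat.cast_smul_eq_nsmul]
    · simp only [f, ← map_mul, ← map_sum, GameAlgebra.sum_e_mul_e (hG x y h), map_zero]
  have hstar (x : X) (a b : Fin n) : star (f x a b) = f x b a := by
    simp only [f, ← map_star, GameAlgebra.star_e]
  have hn : (n : ℝ) ≠ 0 := by
    rintro h
    obtain rfl : n = 0 := by exact_mod_cast h
    simpa using hdiag (Classical.arbitrary X)
  let q (a b : Fin n) : π.carrier := (n : ℝ)⁻¹ • ∑ x, f x a b
  have hq (a b : Fin n) : ∑ c, q a c * q c b = q a b := by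
    simp only [q, smul_mul_smul_comm, Finset.sum_mul_sum, ← Finset.smul_sum]
    rw [Finset.sum_comm]
    simp_rw [Finset.sum_comm (s := (Finset.univ : Finset (Fin n))), hmul]
    simp [← Finset.smul_sum, smul_smul, hn]
  have hqstar (a b : Fin n) : star (q a b) = q b a := by
    simp [q, star_sum, hstar]
  let p (a b : Fin n) : π.carrier := (if a = b then 1 else 0) - q a b
  have hp (a b : Fin n) : ∑ c, star (p c a) * p c b = p a b := by
    simp only [p, star_sub, hqstar, sub_mul, mul_sub, Finset.sum_sub_distrib, hq]
    simp [apply_ite star, eq_comm]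
  -- Each vertex contributes `n⁻¹` to the trace of `q`, since its diagonal units sum to `1`.
  have htr : ∑ i : Fin n × Fin n, star (p i.2 i.1) * p i.2 i.1 =
      algebraMap ℝ π.carrier (n - (n : ℝ)⁻¹ * Fintype.card X) := by
    rw [Fintype.sum_prod_type]
    simp only [hp]
    simp only [p, q, if_true, Finset.sum_sub_distrib, ← Finset.smul_sum]
    rw [Finset.sum_comm]
    simp [hdiag, Algebra.smul_def]
  have h := nonneg_of_sum_star_mul_self_eq_algebraMap _ _ htr
  have hpos : (0 : ℝ) < n := lt_of_le_of_ne n.cast_nonneg hn.symm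
  have h2 : (0 : ℝ) ≤ n * (n - (n : ℝ)⁻¹ * Fintype.card X) := mul_nonneg hpos.le h
  rw [mul_sub, mul_inv_cancel_left₀ hn] at h2
  have h3 : (Fintype.card X : ℝ) ≤ (n : ℝ) ^ 2 := by rw [sq]; linarith
  exact_mod_cast h3

theorem nonempty_cstarRep_of_nontrivial {A : Type*} [Fintype A]
    (h : Nontrivial (cstarGameAlgebra G A)) : Nonempty (CStarRep G A) := by
  by_contra hne
  rw [not_nonempty_iff] at hne
  obtain ⟨a, b, hab⟩ := h
  -- Without representations the direct sum is over an empty family, hence trivial.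
  exact hab (Subtype.ext (lp.ext (funext fun π => hne.elim π)))

theorem le_cstarOrthRank_completeGraph {d : ℕ} (hd : d ≠ 0) :
    (d : ℕ∞) ≤ cstarOrthRank (SimpleGraph.completeGraph (Fin (d ^ 2))) := by
  have : Nonempty (Fin (d ^ 2)) := Fin.pos_iff_nonempty.mp (by positivity)
  refine le_sInf ?_
  rintro _ ⟨n, rfl, hn⟩
  obtain ⟨π⟩ := nonempty_cstarRep_of_nontrivial hn
  have h := card_le_sq_of_cstarRep (fun _ _ hxy => hxy) π
  rw [Fintype.card_fin] at h
  exact_mod_cast (Nat.pow_le_pow_iff_left two_ne_zero).mp h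

end CStar

end CQColouring

theorem proposition5p15 :
    (∀ d : ℕ, 2 ≤ d →
      CQColouring.algOrthRank (SimpleGraph.completeGraph (Fin (d ^ 2))) = 2) ∧
    (∀ d : ℕ, 3 ≤ d →
      CQColouring.algOrthRank (SimpleGraph.completeGraph (Fin (d ^ 2))) <
        CQColouring.cstarOrthRank (SimpleGraph.completeGraph (Fin (d ^ 2)))) := by
  have key (d : ℕ) (hd : 2 ≤ d) :
      CQColouring.algOrthRank (SimpleGraph.completeGraph (Fin (d ^ 2))) = 2 := by
    have h : 2 ≤ d ^ 2 := hd.trans (Nat.le_self_pow two_ne_zero d)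
    exact CQColouring.algOrthRank_eq_two (x := ⟨0, by omega⟩) (y := ⟨1, by omega⟩) (by simp)
  refine ⟨key, fun d hd => ?_⟩
  rw [key d (by omega)]
  refine lt_of_lt_of_le ?_ (CQColouring.le_cstarOrthRank_completeGraph (by omega))
  exact_mod_cast hd
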